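/- Let $A,B\in\mathbb C^{n\times n}$ be such that the pencil $zB-A$ is regular, i.e. $\det(zB-A)$ is not identically zero in $z\in\mathbb C$. An eigenpair of $Ax=\lambda Bx$ is a pair $(\lambda,x)$ with $\lambda\in\mathbb C$, $x\neq 0$ and $Ax=\lambda Bx$; the multiplicity of an eigenvalue $\lambda$ is its multiplicity as a zero of $\det(zB-A)$. Let $\Gamma$ be a positively oriented, simple closed, piecewise continuously differentiable curve in $\mathbb C$ on which there is no eigenvalue (its inside is the set of points off $\Gamma$ whose connected component in $\mathbb C\setminus\Gamma$ is bounded; positively oriented means that $\Gamma$ has winding number $1$ about each inside point). Let $s$ be the number of eigenvalues inside $\Gamma$, counted with multiplicity. Put $$Q=\frac1{2\pi i}\oint_\Gamma (zB-A)^{-1}B\,dz ,$$ and, for a matrix $Y$ with $n$ rows and $s$ columns, put $U=QY$, $\tilde A=(BU)^*AU$ and $\tilde B=(BU)^*BU$. If $Y\in\mathbb C^{n\times s}$ is such that the columns of $U$ are linearly independent, then the following hold. (a) The pencil $z\tilde B-\tilde A$ is regular. If $(\tilde\lambda,y)$ is an eigenpair of $\tilde Ay=\tilde\lambda\tilde By$,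 then $\tilde\lambda$ is inside $\Gamma$ and $(\tilde\lambda,Uy)$ is an eigenpair of $Ax=\lambda Bx$; every eigenpair of $Ax=\lambda Bx$ with eigenvalue inside $\Gamma$ is of this form. The projected problem has exactly $s$ eigenvalues counted with multiplicity, and they are exactly the eigenvalues of $Ax=\lambda Bx$ inside $\Gamma$, with the same multiplicities. (b) For each eigenvalue $\tilde\lambda$ of the projected problem, $U$ maps the eigenspace $\{y\in\mathbb C^s:\tilde Ay=\tilde\lambda\tilde By\}$ onto the eigenspace $\{x\in\mathbb C^n: Ax=\tilde\lambda Bx\}$. Moreover, if the entries of $Y\in\mathbb R^{n\times s}$ are independent, identically distributed random variables with a continuous distribution (one that gives every single point probability $0$), then with probability $1$ the columns of $U=QY$ are linearly independent, and hence (a) and (b) hold. -/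

import Mathlib

open MeasureTheory ProbabilityTheory Polynomial

noncomputable section

namespace ObliqueFEAST

/-! ### Matrix pencils -/

/-- The pencil `z B - A` is regular: `det (z B - A)` is not identically zero in `z`. -/
def IsRegularPencil {n : ℕ} (A B : Matrix (Fin n) (Fin n) ℂ) : Prop :=
  ∃ z : ℂ, (z • B - A).det ≠ 0

/-- `(μ, x)` is an eigenpair of the generalized eigenvalue problem `A x = μ B x`. -/
def IsEigenpair {n : ℕ} (A B : Matrix (Fin n) (Fin n) ℂ) (μ : ℂ) (x : Fin n → ℂ) : Prop :=
  x ≠ 0 ∧ A.mulVec x = μ • B.mulVec x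

/-- The eigenspace `{x | A x = μ B x}`. -/
def eigenspace {n : ℕ} (A B : Matrix (Fin n) (Fin n) ℂ) (μ : ℂ) : Submodule ℂ (Fin n → ℂ) :=
  LinearMap.ker (A - μ • B).mulVecLin

/-- The polynomial `det (z B - A)` in the indeterminate `z`. -/
def pencilPoly {n : ℕ} (A B : Matrix (Fin n) (Fin n) ℂ) : ℂ[X] :=
  ((X : ℂ[X]) • B.map C - A.map C).det

/-- The eigenvalues of the pencil, each repeated according to its algebraic multiplicity, that is
its multiplicity as a zero of `det (z B - A)`. -/
def eigenvalues {n : ℕ} (A B : Matrix (Fin n) (Fin n) ℂ) : Multiset ℂ :=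
  (pencilPoly A B).roots

open Classical in
/-- The eigenvalues of the pencil lying in the set `D`, with multiplicity. -/
def eigenvaluesIn {n : ℕ} (A B : Matrix (Fin n) (Fin n) ℂ) (D : Set ℂ) : Multiset ℂ :=
  (eigenvalues A B).filter (fun z => z ∈ D)

/-! ### Contours -/

/-- The contour integral `∮ f(z) dz` along the closed path `γ`. -/
def contourIntegral {c : ℂ} (γ : Path c c) (f : ℂ → ℂ) : ℂ :=
  curveIntegral (fun z : ℂ => f z • (1 : ℂ →L[ℂ] ℂ)) γ

/-- The winding number of `γ` about a point `w` off the curve. -/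
def windingNumber {c : ℂ} (γ : Path c c) (w : ℂ) : ℂ :=
  (2 * (Real.pi : ℂ) * Complex.I)⁻¹ * contourIntegral γ (fun z => (z - w)⁻¹)

/-- The region enclosed by `γ`: the points off the curve whose connected component in the
complement of the curve is bounded. -/
def inside {c : ℂ} (γ : Path c c) : Set ℂ :=
  {w | w ∉ Set.range γ ∧ Bornology.IsBounded (connectedComponentIn (Set.range γ)ᶜ w)}

/-- `γ` is a positively oriented, simple, closed, piecewise continuously differentiable curve. -/
structure IsContour {c : ℂ} (γ : Path c c) : Prop where
  /-- `γ` is continuously differentiable on each piece of a finite subdivision of `[0, 1]`. -/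
  piecewise_contDiff : ∃ (k : ℕ) (t : ℕ → ℝ), Monotone t ∧ t 0 = 0 ∧ t k = 1 ∧
    ∀ i < k, ContDiffOn ℝ 1 γ.extend (Set.Icc (t i) (t (i + 1)))
  /-- `γ` does not meet itself, except that its two ends coincide. -/
  simple : Set.InjOn γ.extend (Set.Ico 0 1)
  /-- `γ` runs once counterclockwise around each point that it encloses. -/
  positive : ∀ w ∈ inside γ, windingNumber γ w = 1

/-- The matrix `Q = (1 / 2πi) ∮ (z B - A)⁻¹ B dz`, the integral being taken entrywise. -/
def contourProjector {n : ℕ} (A B : Matrix (Fin n) (Fin n) ℂ) {c : ℂ} (γ : Path c c) :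
    Matrix (Fin n) (Fin n) ℂ :=
  Matrix.of fun i j =>
    (2 * (Real.pi : ℂ) * Complex.I)⁻¹ * contourIntegral γ (fun z => ((z • B - A)⁻¹ * B) i j)

/-! ### The projected problem -/

/-- The oblique projection `(B U)^* M U` of a matrix `M` (search space: the column space of `U`,
test space: the column space of `B U`). -/
def obliqueProj {n s : ℕ} (B : Matrix (Fin n) (Fin n) ℂ) (U : Matrix (Fin n) (Fin s) ℂ)
    (M : Matrix (Fin n) (Fin n) ℂ) : Matrix (Fin s) (Fin s) ℂ :=
  (B * U).conjTranspose * M * U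

/-- The projected pencil `z B' - A'`, with `A' = (B U)^* A U` and `B' = (B U)^* B U`, yields through
`y ↦ U y` exactly the eigenpairs of `A x = μ B x` whose eigenvalue lies in `D`. -/
structure ProjectionIsExact {n s : ℕ} (A B : Matrix (Fin n) (Fin n) ℂ) (D : Set ℂ)
    (U : Matrix (Fin n) (Fin s) ℂ) : Prop where
  /-- The projected pencil is regular. -/
  regular : IsRegularPencil (obliqueProj B U A) (obliqueProj B U B)
  /-- Each eigenpair of the projected problem lifts to an eigenpair with eigenvalue in `D`. -/
  lift : ∀ (μ : ℂ) (y : Fin s → ℂ), IsEigenpair (obliqueProj B U A) (obliqueProj B U B) μ y →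
    μ ∈ D ∧ IsEigenpair A B μ (U.mulVec y)
  /-- Each eigenpair with eigenvalue in `D` is obtained in this way. -/
  exhaust : ∀ (μ : ℂ) (x : Fin n → ℂ), μ ∈ D → IsEigenpair A B μ x →
    ∃ y : Fin s → ℂ, IsEigenpair (obliqueProj B U A) (obliqueProj B U B) μ y ∧ U.mulVec y = x
  /-- There are `s` projected eigenvalues, counted with multiplicity. -/
  card_eigenvalues : (eigenvalues (obliqueProj B U A) (obliqueProj B U B)).card = s
  /-- The projected eigenvalues are exactly the eigenvalues in `D`, with multiplicities. -/
  eigenvalues_eq : eigenvalues (obliqueProj B U A) (obliqueProj B U B) = eigenvaluesIn A B D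
  /-- `U` maps each eigenspace of the projected problem onto the eigenspace of `A x = μ B x`. -/
  map_eigenspace : ∀ μ : ℂ,
    (∃ y : Fin s → ℂ, IsEigenpair (obliqueProj B U A) (obliqueProj B U B) μ y) →
    (eigenspace (obliqueProj B U A) (obliqueProj B U B) μ).map U.mulVecLin = eigenspace A B μ

end ObliqueFEAST

end

/-! Fix `z₀` with `z₀ B - A` invertible and let `R = (z₀ B - A)⁻¹ B`. Since `z B - A = (z₀ B - A)(1
+ (z - z₀) R)`, an eigenvalue `ν ≠ 0` of `R` corresponds to the eigenvalue `z₀ - ν⁻¹` of the pencil,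
and `ν = 0` to infinity; `B` may be singular. On a generalized eigenvector `v` of `R`, `(z B - A)⁻¹
B v` is polynomial in `z` if `ν = 0`, and otherwise has its only pole at `z₀ - ν⁻¹`, with residue
`v`. Polynomials and higher-order poles have primitives, so only the winding number survives: 1
inside, 0 outside. Hence `Q` is a spectral projector of `R` (`IsContour.contourProjector_mulVec`).

Factor `Q = U V` with `V U = 1`. Then `A U = B U M`, where the characteristic polynomial of `M` is,
up to a constant, the factor of `det (z B - A)` carrying the zeros inside (`exists_isDeflation`).
The projected pencil is `(B U)^* (B U) (z - M)` with invertible Gram matrix, so its spectral data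
are those of `M`. If `Q Y = U (V Y)` has independent columns, `V Y` is invertible and `Q Y` serves
as another such `U`. For random `Y`, `det (V Y)` is a nonzero polynomial in independent diffuse
variables, hence almost surely nonzero. -/

noncomputable section

namespace ObliqueFEAST

/-! ### Contour integrals along piecewise continuously differentiable paths -/

section Contour

variable {c : ℂ} {γ : Path c c}

/-- `γ` is continuously differentiable on each piece of a finite subdivision of `[0, 1]`. -/
def IsPiecewiseC1 (γ : Path c c) : Prop :=
  ∃ (k : ℕ) (t : ℕ → ℝ), Monotone t ∧ t 0 = 0 ∧ t k = 1 ∧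
    ∀ i < k, ContDiffOn ℝ 1 γ.extend (Set.Icc (t i) (t (i + 1)))

lemma curveIntegralFun_smul_one (f : ℂ → ℂ) (x : ℝ) :
    curveIntegralFun (fun z : ℂ => f z • (1 : ℂ →L[ℂ] ℂ)) γ x =
      f (γ.extend x) * derivWithin γ.extend (Set.Icc 0 1) x := by
  rw [curveIntegralFun_def]
  simp

lemma extend_mem_range (x : ℝ) : γ.extend x ∈ Set.range γ := by
  simp [Path.extend, Set.IccExtend]

/-- The derivative within the piece is continuous up to its ends; the derivative within `[0, 1]`
agrees with it in the interior, which suffices for integrability. -/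
lemma intervalIntegrable_piece {f : ℂ → ℂ} (hf : ContinuousOn f (Set.range γ)) {a b : ℝ}
    (hab : a ≤ b) (ha : 0 ≤ a) (hb : b ≤ 1) (h : ContDiffOn ℝ 1 γ.extend (Set.Icc a b)) :
    IntervalIntegrable (curveIntegralFun (fun z : ℂ => f z • (1 : ℂ →L[ℂ] ℂ)) γ) volume a b := by
  rcases hab.eq_or_lt with rfl | hlt
  · exact IntervalIntegrable.refl
  have hcont : ContinuousOn
      (fun x => f (γ.extend x) * derivWithin γ.extend (Set.Icc a b) x) (Set.uIcc a b) := by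
    rw [Set.uIcc_of_le hab]
    refine ContinuousOn.mul ?_ (h.continuousOn_derivWithin (uniqueDiffOn_Icc hlt) le_rfl)
    exact hf.comp γ.continuous_extend.continuousOn fun x _ => extend_mem_range x
  refine hcont.intervalIntegrable.congr_uIoo fun x hx => ?_
  rw [Set.uIoo_of_le hab] at hx
  simp only [curveIntegralFun_smul_one]
  rw [derivWithin_of_mem_nhds (Icc_mem_nhds hx.1 hx.2),
    derivWithin_of_mem_nhds (Icc_mem_nhds (ha.trans_lt hx.1) (hx.2.trans_le hb))]

lemma IsPiecewiseC1.curveIntegrable (h : IsPiecewiseC1 γ) {f : ℂ → ℂ}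
    (hf : ContinuousOn f (Set.range γ)) :
    CurveIntegrable (fun z : ℂ => f z • (1 : ℂ →L[ℂ] ℂ)) γ := by
  obtain ⟨k, t, ht, h0, h1, hC⟩ := h
  rw [CurveIntegrable, ← h0, ← h1]
  refine IntervalIntegrable.trans_iterate fun i hi => ?_
  exact intervalIntegrable_piece hf (ht i.le_succ) (h0 ▸ ht i.zero_le) (h1 ▸ ht hi) (hC i hi)

/-- A function with a primitive along a closed curve integrates to zero. -/
lemma IsPiecewiseC1.contourIntegral_eq_zero (h : IsPiecewiseC1 γ) {f F : ℂ → ℂ}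
    (hf : ContinuousOn f (Set.range γ)) (hF : ∀ z ∈ Set.range γ, HasDerivAt F (f z) z) :
    contourIntegral γ f = 0 := by
  obtain ⟨k, t, ht, h0, h1, hC⟩ := h
  have hint : ∀ i < k, IntervalIntegrable
      (curveIntegralFun (fun z : ℂ => f z • (1 : ℂ →L[ℂ] ℂ)) γ) volume (t i) (t (i + 1)) :=
    fun i hi => intervalIntegrable_piece hf (ht i.le_succ) (h0 ▸ ht i.zero_le) (h1 ▸ ht hi)
      (hC i hi)
  have hpiece : ∀ i ∈ Finset.range k,
      ∫ x in (t i)..(t (i + 1)), curveIntegralFun (fun z : ℂ => f z • (1 : ℂ →L[ℂ] ℂ)) γ x =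
        F (γ.extend (t (i + 1))) - F (γ.extend (t i)) := by
    intro i hi
    rw [Finset.mem_range] at hi
    refine intervalIntegral.integral_eq_sub_of_hasDerivAt_of_le (f := fun x => F (γ.extend x))
      (ht i.le_succ) ?_ ?_ (hint i hi)
    · exact fun x _ => ((hF _ (extend_mem_range x)).continuousAt.comp
        γ.continuous_extend.continuousAt).continuousWithinAt
    · intro x hx
      have hx0 : 0 < x := (h0 ▸ ht i.zero_le : 0 ≤ t i).trans_lt hx.1
      have hx1 : x < 1 := hx.2.trans_le (h1 ▸ ht hi)
      have hd : DifferentiableAt ℝ γ.extend x :=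
        ((hC i hi).differentiableOn one_ne_zero).differentiableAt (Icc_mem_nhds hx.1 hx.2)
      rw [curveIntegralFun_smul_one, derivWithin_of_mem_nhds (Icc_mem_nhds hx0 hx1)]
      exact (hF _ (extend_mem_range x)).comp_of_eq x hd.hasDerivAt rfl
  -- The increments of `F` over the pieces telescope, and the two ends of `γ` coincide.
  rw [contourIntegral, curveIntegral_def, ← h0, ← h1,
    ← intervalIntegral.sum_integral_adjacent_intervals hint, Finset.sum_congr rfl hpiece,
    Finset.sum_range_sub (fun i => F (γ.extend (t i))), h0, h1]
  simp

lemma contourIntegral_congr {f g : ℂ → ℂ} (h : ∀ z ∈ Set.range γ, f z = g z) :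
    contourIntegral γ f = contourIntegral γ g := by
  rw [contourIntegral, contourIntegral, curveIntegral_def, curveIntegral_def]
  refine intervalIntegral.integral_congr fun x _ => ?_
  simp only [curveIntegralFun_smul_one, h _ (extend_mem_range x)]

lemma contourIntegral_const_mul (a : ℂ) (f : ℂ → ℂ) :
    contourIntegral γ (fun z => a * f z) = a * contourIntegral γ f := by
  rw [contourIntegral, contourIntegral, curveIntegral_def, curveIntegral_def]
  simp only [curveIntegralFun_smul_one, mul_assoc, intervalIntegral.integral_const_mul]

lemma IsPiecewiseC1.contourIntegral_add (h : IsPiecewiseC1 γ) {f g : ℂ → ℂ}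
    (hf : ContinuousOn f (Set.range γ)) (hg : ContinuousOn g (Set.range γ)) :
    contourIntegral γ (fun z => f z + g z) = contourIntegral γ f + contourIntegral γ g := by
  rw [contourIntegral, contourIntegral, contourIntegral,
    ← curveIntegral_fun_add (h.curveIntegrable hf) (h.curveIntegrable hg)]
  refine congrArg (fun ω => curveIntegral ω γ) (funext fun z => ?_)
  ext
  simp

lemma IsPiecewiseC1.contourIntegral_sum (h : IsPiecewiseC1 γ) {ι : Type*} (S : Finset ι)
    {f : ι → ℂ → ℂ} (hf : ∀ i ∈ S, ContinuousOn (f i) (Set.range γ)) :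
    contourIntegral γ (fun z => ∑ i ∈ S, f i z) = ∑ i ∈ S, contourIntegral γ (f i) := by
  classical
  induction S using Finset.induction_on with
  | empty =>
    simp only [Finset.sum_empty]
    simpa using contourIntegral_const_mul (γ := γ) 0 0
  | insert a S ha ih =>
    simp only [Finset.sum_insert ha]
    rw [h.contourIntegral_add (hf a (by simp))
      (continuousOn_finsetSum _ fun i hi => hf i (by simp [hi])),
      ih fun i hi => hf i (by simp [hi])]

/-! ### Winding numbers -/

lemma continuousOn_inv_sub {w : ℂ} (hw : w ∉ Set.range γ) :
    ContinuousOn (fun z : ℂ => (z - w)⁻¹) (Set.range γ) := by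
  refine ContinuousOn.inv₀ (by fun_prop) fun z hz h => hw ?_
  rwa [← sub_eq_zero.1 h]

/-- The winding number does not change under small displacements. -/
lemma IsPiecewiseC1.windingNumber_eventually_eq (h : IsPiecewiseC1 γ) {w : ℂ}
    (hw : w ∉ Set.range γ) : ∀ᶠ w' in nhds w, windingNumber γ w' = windingNumber γ w := by
  obtain ⟨r, hr, hball⟩ :=
    Metric.isOpen_iff.1 (isCompact_range γ.continuous).isClosed.isOpen_compl w hw
  filter_upwards [Metric.ball_mem_nhds w hr] with w' hw'
  have hw'γ : w' ∉ Set.range γ := hball hw'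
  -- On the curve `|w - w'| < r ≤ |z - w|`, so `(z - w') / (z - w)` lies in the unit disc about 1,
  -- where the principal logarithm is differentiable.
  have key : contourIntegral γ (fun z => (z - w')⁻¹ + (-1) * (z - w)⁻¹) = 0 := by
    refine h.contourIntegral_eq_zero (F := fun z => Complex.log ((z - w') / (z - w)))
      ((continuousOn_inv_sub hw'γ).add (continuousOn_const.mul (continuousOn_inv_sub hw))) ?_
    intro z hz
    have hzw : z - w ≠ 0 := fun e => hw (sub_eq_zero.1 e ▸ hz)
    have hzw' : z - w' ≠ 0 := fun e => hw'γ (sub_eq_zero.1 e ▸ hz)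
    have hlt : ‖(w - w') / (z - w)‖ < 1 := by
      rw [norm_div, div_lt_one (norm_pos_iff.2 hzw), norm_sub_rev w, ← dist_eq_norm,
        ← dist_eq_norm]
      refine lt_of_lt_of_le (Metric.mem_ball.1 hw') (not_lt.1 fun hlt => ?_)
      exact hball (Metric.mem_ball.2 hlt) hz
    have hslit : (z - w') / (z - w) ∈ Complex.slitPlane := by
      have : (z - w') / (z - w) = 1 + (w - w') / (z - w) := by field_simp; ring
      rw [this]
      exact Complex.mem_slitPlane_of_norm_lt_one hlt
    have hd : HasDerivAt (fun z : ℂ => (z - w') / (z - w))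
        ((1 * (z - w) - (z - w') * 1) / (z - w) ^ 2) z :=
      ((hasDerivAt_id z).sub_const w').div ((hasDerivAt_id z).sub_const w) hzw
    refine (hd.clog hslit).congr_deriv ?_
    field_simp
    ring
  rw [h.contourIntegral_add (continuousOn_inv_sub hw'γ)
    (g := fun z => (-1) * (z - w)⁻¹) (continuousOn_const.mul (continuousOn_inv_sub hw)),
    contourIntegral_const_mul] at key
  rw [windingNumber, windingNumber]
  congr 1
  linear_combination key

/-- Since `|z / w| < 1` on the curve, `log (1 - z / w)` is a primitive of `(z - w)⁻¹` there. -/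
lemma IsPiecewiseC1.windingNumber_eq_zero_of_norm_lt (h : IsPiecewiseC1 γ) {w : ℂ}
    (hw : ∀ z ∈ Set.range γ, ‖z‖ < ‖w‖) : windingNumber γ w = 0 := by
  have hwγ : w ∉ Set.range γ := fun hmem => (hw w hmem).false
  rw [windingNumber, h.contourIntegral_eq_zero (F := fun z => Complex.log (1 + -(z / w)))
    (continuousOn_inv_sub hwγ), mul_zero]
  intro z hz
  have hw0 : w ≠ 0 := norm_pos_iff.1 ((norm_nonneg z).trans_lt (hw z hz))
  have hzw : z - w ≠ 0 := fun e => hwγ (sub_eq_zero.1 e ▸ hz)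
  have hslit : 1 + -(z / w) ∈ Complex.slitPlane := by
    refine Complex.mem_slitPlane_of_norm_lt_one ?_
    rw [norm_neg, norm_div, div_lt_one (norm_pos_iff.2 hw0)]
    exact hw z hz
  have hd : HasDerivAt (fun z : ℂ => 1 + -(z / w)) (-(1 / w)) z :=
    (((hasDerivAt_id z).div_const w).neg).const_add 1
  refine (hd.clog hslit).congr_deriv ?_
  have : 1 + -(z / w) = -(z - w) / w := by field_simp; ring
  rw [this]
  field_simp

lemma IsPiecewiseC1.windingNumber_eq_of_mem_component (h : IsPiecewiseC1 γ) {w w' : ℂ}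
    (hw' : w' ∈ connectedComponentIn (Set.range γ)ᶜ w) :
    windingNumber γ w' = windingNumber γ w := by
  have hw : w ∈ (Set.range γ)ᶜ := by
    by_contra hcon
    rw [connectedComponentIn_eq_empty hcon] at hw'
    exact hw'
  refine isPreconnected_connectedComponentIn.induction₂
    (fun x y => windingNumber γ x = windingNumber γ y) (fun x hx => ?_)
    (fun _ _ _ _ _ _ => Eq.trans) (fun _ _ _ _ => Eq.symm) hw' (mem_connectedComponentIn hw)
  have hxγ : x ∉ Set.range γ := connectedComponentIn_subset _ _ hx
  exact ((h.windingNumber_eventually_eq hxγ).filter_mono nhdsWithin_le_nhds).mono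
    fun _ => Eq.symm

/-- The winding number of a contour about a point off the curve that it does not enclose. -/
lemma IsPiecewiseC1.windingNumber_eq_zero (h : IsPiecewiseC1 γ) {w : ℂ}
    (hw : w ∉ Set.range γ) (hout : w ∉ inside γ) : windingNumber γ w = 0 := by
  have hunb : ¬ Bornology.IsBounded (connectedComponentIn (Set.range γ)ᶜ w) :=
    fun hb => hout ⟨hw, hb⟩
  obtain ⟨R, hR⟩ := (isCompact_range γ.continuous).isBounded.exists_norm_le
  -- The unbounded component leaves the disc containing the curve; the winding number is constant on
  -- it and vanishes out there.
  have : ∃ w' ∈ connectedComponentIn (Set.range γ)ᶜ w, R < ‖w'‖ := by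
    by_contra! hcon
    exact hunb (isBounded_iff_forall_norm_le.2 ⟨R, hcon⟩)
  obtain ⟨w', hw', hlt⟩ := this
  rw [← h.windingNumber_eq_of_mem_component hw']
  exact h.windingNumber_eq_zero_of_norm_lt fun z hz => (hR z hz).trans_lt hlt

end Contour

/-! ### The resolvent on generalized eigenvectors -/

section Resolvent

variable {n : ℕ} {A B : Matrix (Fin n) (Fin n) ℂ}

/-- The resolvent `(z B - A)⁻¹ B` of the pencil. -/
def resolvent (A B : Matrix (Fin n) (Fin n) ℂ) (z : ℂ) : Matrix (Fin n) (Fin n) ℂ :=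
  (z • B - A)⁻¹ * B

lemma pencil_mul_inv {z : ℂ} (hz : (z • B - A).det ≠ 0) : (z • B - A) * (z • B - A)⁻¹ = 1 :=
  Matrix.mul_nonsing_inv _ (isUnit_iff_ne_zero.2 hz)

lemma pencil_inv_mul {z : ℂ} (hz : (z • B - A).det ≠ 0) : (z • B - A)⁻¹ * (z • B - A) = 1 :=
  Matrix.nonsing_inv_mul _ (isUnit_iff_ne_zero.2 hz)

lemma pencil_mul_resolvent {z : ℂ} (hz : (z • B - A).det ≠ 0) :
    (z • B - A) * resolvent A B z = B := by
  rw [resolvent, ← mul_assoc, pencil_mul_inv hz, one_mul]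

lemma pencil_eq_mul {z₀ : ℂ} (h₀ : (z₀ • B - A).det ≠ 0) (z : ℂ) :
    z • B - A = (z₀ • B - A) * (1 + (z - z₀) • resolvent A B z₀) := by
  rw [mul_add, mul_one, mul_smul_comm, pencil_mul_resolvent h₀]
  module

/-- A form of the resolvent identity that needs no inverse of `B`. -/
lemma resolvent_mul {z₀ z : ℂ} (h₀ : (z₀ • B - A).det ≠ 0) (hz : (z • B - A).det ≠ 0) :
    resolvent A B z * (1 + (z - z₀) • resolvent A B z₀) = resolvent A B z₀ := by
  have h : B * (1 + (z - z₀) • resolvent A B z₀) = (z • B - A) * resolvent A B z₀ := by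
    conv_rhs => rw [show z • B - A = (z₀ • B - A) + (z - z₀) • B by module]
    rw [add_mul, pencil_mul_resolvent h₀, mul_add, mul_one, mul_smul_comm, smul_mul_assoc]
  rw [resolvent, mul_assoc, h, ← mul_assoc, pencil_inv_mul hz, one_mul]

/-- The recursion behind the next two inductions: `(R - ν) v` is killed by a lower power of `R - ν`
than `v`. -/
lemma resolvent_mulVec {z₀ z : ℂ} (h₀ : (z₀ • B - A).det ≠ 0) (hz : (z • B - A).det ≠ 0) (ν : ℂ)
    (v : Fin n → ℂ) :
    (1 + (z - z₀) * ν) • (resolvent A B z).mulVec v =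
      ν • v + (resolvent A B z₀ - ν • 1).mulVec v
        - (z - z₀) • (resolvent A B z).mulVec ((resolvent A B z₀ - ν • 1).mulVec v) := by
  have h := congrArg (fun M => M.mulVec v) (resolvent_mul h₀ hz)
  simp only [← Matrix.mulVec_mulVec, Matrix.add_mulVec, Matrix.one_mulVec, Matrix.mulVec_add,
    Matrix.smul_mulVec, Matrix.mulVec_smul] at h
  simp only [Matrix.sub_mulVec, Matrix.smul_mulVec, Matrix.one_mulVec, Matrix.mulVec_sub,
    Matrix.mulVec_smul]
  linear_combination (norm := module) h

/-- On a generalized eigenvector of `resolvent A B z₀` for the eigenvalue `0`, the resolvent is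
a polynomial. -/
lemma resolvent_mulVec_of_zero {z₀ : ℂ} (h₀ : (z₀ • B - A).det ≠ 0) (k : ℕ) (v : Fin n → ℂ)
    (hv : ((resolvent A B z₀ - (0 : ℂ) • 1) ^ k).mulVec v = 0) :
    ∃ p : Fin n → ℂ[X], ∀ z, (z • B - A).det ≠ 0 →
      ∀ i, (resolvent A B z).mulVec v i = (p i).eval z := by
  induction k generalizing v with
  | zero =>
    have : v = 0 := by simpa using hv
    exact ⟨0, fun z _ i => by simp [this]⟩
  | succ k ih =>
    obtain ⟨p, hp⟩ := ih ((resolvent A B z₀ - (0 : ℂ) • 1).mulVec v) (by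
      rw [Matrix.mulVec_mulVec, ← pow_succ, hv])
    refine ⟨fun i => C ((resolvent A B z₀ - (0 : ℂ) • 1).mulVec v i) - (X - C z₀) * p i,
      fun z hz i => ?_⟩
    have h := congrFun (resolvent_mulVec h₀ hz 0 v) i
    simp only [Pi.smul_apply, Pi.sub_apply, Pi.add_apply, smul_eq_mul, hp z hz i] at h
    simp only [eval_sub, eval_C, eval_mul, eval_X]
    linear_combination h

/-- On a generalized eigenvector of `resolvent A B z₀` for the eigenvalue `ν ≠ 0`, the resolvent
has its only pole at `z₀ - ν⁻¹`, with residue the identity. -/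
lemma resolvent_mulVec_of_ne_zero {z₀ : ℂ} (h₀ : (z₀ • B - A).det ≠ 0) {ν : ℂ} (hν : ν ≠ 0) (k : ℕ)
    (v : Fin n → ℂ) (hv : ((resolvent A B z₀ - ν • 1) ^ k).mulVec v = 0) :
    ∃ p : Fin n → ℂ[X], ∀ z, (z • B - A).det ≠ 0 → z ≠ z₀ - ν⁻¹ →
      ∀ i, (resolvent A B z).mulVec v i = v i * (z - (z₀ - ν⁻¹))⁻¹ +
        (z - (z₀ - ν⁻¹))⁻¹ ^ 2 * (p i).eval (z - (z₀ - ν⁻¹))⁻¹ := by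
  induction k generalizing v with
  | zero =>
    have : v = 0 := by simpa using hv
    exact ⟨0, fun z _ _ i => by simp [this]⟩
  | succ k ih =>
    set w := (resolvent A B z₀ - ν • 1).mulVec v with hw
    obtain ⟨p, hp⟩ := ih w (by rw [hw, Matrix.mulVec_mulVec, ← pow_succ, hv])
    -- With `ζ = (z - (z₀ - ν⁻¹))⁻¹` and `g` the resolvent value, the recursion reads `ν g = ζ (ν v
    -- + w) - (1 - ν⁻¹ ζ)(ζ w + ζ² p(ζ))`. The terms `ζ w` cancel, so the residue stays `v`; the
    -- rest, divided by `ν ζ²`, is this polynomial.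
    refine ⟨fun i => C ν⁻¹ * (C (ν⁻¹ * w i) - p i + C ν⁻¹ * X * p i), fun z hz hzl i => ?_⟩
    have h := congrFun (resolvent_mulVec h₀ hz ν v) i
    rw [← hw] at h
    simp only [Pi.smul_apply, Pi.sub_apply, Pi.add_apply, smul_eq_mul, hp z hz hzl i] at h
    simp only [eval_sub, eval_C, eval_mul, eval_X, eval_add]
    have hne : z - (z₀ - ν⁻¹) ≠ 0 := sub_ne_zero.2 hzl
    set ζ := (z - (z₀ - ν⁻¹))⁻¹ with hζ
    have hζ1 : ζ * (z - (z₀ - ν⁻¹)) = 1 := inv_mul_cancel₀ hne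
    have e1 : z - z₀ = (z - (z₀ - ν⁻¹)) - ν⁻¹ := by ring
    set u := z - (z₀ - ν⁻¹) with hu
    set q := (p i).eval ζ
    rw [e1] at h
    have hνν : ν⁻¹ * ν = 1 := inv_mul_cancel₀ hν
    set τ := ν⁻¹
    set g := (resolvent A B z).mulVec v i
    have h2 : u * (ν * g) = ν * v i + w i - (u - τ) * (w i * ζ + ζ ^ 2 * q) := by
      linear_combination h + g * hνν
    have h3 : ν * g = ζ * (ν * v i + w i) - (1 - ζ * τ) * (w i * ζ + ζ ^ 2 * q) := by
      linear_combination ζ * h2 - (ν * g + (w i * ζ + ζ ^ 2 * q)) * hζ1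
    linear_combination τ * h3 - g * hνν + ζ * v i * hνν

/-- A generalized eigenvalue of `resolvent A B z₀` gives an eigenvalue of the pencil. -/
lemma det_eq_zero_of_mulVec_pow {z₀ : ℂ} (h₀ : (z₀ • B - A).det ≠ 0) {ν : ℂ} (hν : ν ≠ 0) (k : ℕ)
    {v : Fin n → ℂ} (hv : ((resolvent A B z₀ - ν • 1) ^ k).mulVec v = 0) (hv0 : v ≠ 0) :
    ((z₀ - ν⁻¹) • B - A).det = 0 := by
  have hdet : ((resolvent A B z₀ - ν • 1) ^ k).det = 0 :=
    Matrix.exists_mulVec_eq_zero_iff.1 ⟨v, hv0, hv⟩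
  rw [Matrix.det_pow] at hdet
  rw [pencil_eq_mul h₀, Matrix.det_mul]
  have : (1 + (z₀ - ν⁻¹ - z₀) • resolvent A B z₀) = (-ν⁻¹) • (resolvent A B z₀ - ν • 1) := by
    rw [smul_sub, smul_smul, neg_mul, inv_mul_cancel₀ hν]
    module
  rw [this, Matrix.det_smul, eq_zero_of_pow_eq_zero hdet, mul_zero, mul_zero]

end Resolvent

/-! ### The contour projector on generalized eigenvectors -/

section Projector

variable {n : ℕ} {A B : Matrix (Fin n) (Fin n) ℂ} {c : ℂ} {γ : Path c c}

lemma exists_derivative_eq (p : ℂ[X]) : ∃ P : ℂ[X], derivative P = p := by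
  induction p using Polynomial.induction_on' with
  | add p q hp hq =>
    obtain ⟨P, rfl⟩ := hp
    obtain ⟨Q, rfl⟩ := hq
    exact ⟨P + Q, derivative_add⟩
  | monomial k a =>
    refine ⟨monomial (k + 1) (a / (k + 1)), ?_⟩
    rw [derivative_monomial]
    have : ((k : ℂ) + 1) ≠ 0 := by exact_mod_cast k.succ_ne_zero
    push_cast
    simp [div_mul_cancel₀ _ this]

lemma IsPiecewiseC1.contourIntegral_polynomial (h : IsPiecewiseC1 γ) (p : ℂ[X]) :
    contourIntegral γ (fun z => p.eval z) = 0 := by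
  obtain ⟨P, rfl⟩ := exists_derivative_eq p
  exact h.contourIntegral_eq_zero (Polynomial.continuous _).continuousOn fun z _ => P.hasDerivAt z

lemma continuousOn_inv_sq_mul_eval {w : ℂ} (hw : w ∉ Set.range γ) (p : ℂ[X]) :
    ContinuousOn (fun z => (z - w)⁻¹ ^ 2 * p.eval (z - w)⁻¹) (Set.range γ) :=
  ((continuousOn_inv_sub hw).pow 2).mul (p.continuous.comp_continuousOn (continuousOn_inv_sub hw))

/-- The factor `(z - w)⁻²` is minus the derivative of `(z - w)⁻¹`, so an antiderivative of `p`
yields a primitive. -/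
lemma IsPiecewiseC1.contourIntegral_inv_sq_mul_eval (h : IsPiecewiseC1 γ) {w : ℂ}
    (hw : w ∉ Set.range γ) (p : ℂ[X]) :
    contourIntegral γ (fun z => (z - w)⁻¹ ^ 2 * p.eval (z - w)⁻¹) = 0 := by
  obtain ⟨P, rfl⟩ := exists_derivative_eq p
  refine h.contourIntegral_eq_zero (F := fun z => -P.eval (z - w)⁻¹)
    (continuousOn_inv_sq_mul_eval hw _) fun z hz => ?_
  have hne : z - w ≠ 0 := fun e => hw (sub_eq_zero.1 e ▸ hz)
  have hd : HasDerivAt (fun z => (z - w)⁻¹) (-1 / (z - w) ^ 2) z :=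
    ((hasDerivAt_id z).sub_const w).inv hne
  refine (((P.hasDerivAt _).comp z hd).neg).congr_deriv ?_
  field_simp

lemma continuousOn_resolvent (hoff : ∀ z ∈ Set.range γ, (z • B - A).det ≠ 0) (i j : Fin n) :
    ContinuousOn (fun z => resolvent A B z i j) (Set.range γ) := by
  have hc : Continuous fun z : ℂ => z • B - A := by fun_prop
  have : ContinuousOn (fun z : ℂ => ((z • B - A).det)⁻¹ • ((z • B - A).adjugate * B) i j)
      (Set.range γ) :=
    (hc.matrix_det.continuousOn.inv₀ hoff).smul
      ((hc.matrix_adjugate.matrix_mul continuous_const).matrix_elem i j).continuousOn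
  refine this.congr fun z _ => ?_
  simp [resolvent, Matrix.inv_def, Ring.inverse_eq_inv']

lemma IsPiecewiseC1.contourProjector_mulVec (h : IsPiecewiseC1 γ)
    (hoff : ∀ z ∈ Set.range γ, (z • B - A).det ≠ 0) (v : Fin n → ℂ) (i : Fin n) :
    (contourProjector A B γ).mulVec v i = (2 * (Real.pi : ℂ) * Complex.I)⁻¹ *
      contourIntegral γ (fun z => (resolvent A B z).mulVec v i) := by
  simp only [Matrix.mulVec, dotProduct, mul_comm _ (v _)]
  rw [h.contourIntegral_sum Finset.univ (f := fun j z => v j * resolvent A B z i j)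
    fun j _ => continuousOn_const.mul (continuousOn_resolvent hoff i j), Finset.mul_sum]
  refine Finset.sum_congr rfl fun j _ => ?_
  rw [contourIntegral_const_mul]
  simp only [contourProjector, Matrix.of_apply, resolvent]
  ring

lemma IsPiecewiseC1.contourProjector_mulVec_of_zero (h : IsPiecewiseC1 γ)
    (hoff : ∀ z ∈ Set.range γ, (z • B - A).det ≠ 0) {z₀ : ℂ} (h₀ : (z₀ • B - A).det ≠ 0) (k : ℕ)
    {v : Fin n → ℂ} (hv : ((resolvent A B z₀ - (0 : ℂ) • 1) ^ k).mulVec v = 0) :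
    (contourProjector A B γ).mulVec v = 0 := by
  obtain ⟨p, hp⟩ := resolvent_mulVec_of_zero h₀ k v hv
  ext i
  rw [h.contourProjector_mulVec hoff, contourIntegral_congr fun z hz => hp z (hoff z hz) i,
    h.contourIntegral_polynomial, mul_zero, Pi.zero_apply]

lemma IsPiecewiseC1.contourProjector_mulVec_of_ne_zero (h : IsPiecewiseC1 γ)
    (hoff : ∀ z ∈ Set.range γ, (z • B - A).det ≠ 0) {z₀ : ℂ} (h₀ : (z₀ • B - A).det ≠ 0) {ν : ℂ}
    (hν : ν ≠ 0) (k : ℕ) {v : Fin n → ℂ} (hv : ((resolvent A B z₀ - ν • 1) ^ k).mulVec v = 0) :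
    (contourProjector A B γ).mulVec v = windingNumber γ (z₀ - ν⁻¹) • v := by
  -- Only for `v = 0` could `z₀ - ν⁻¹` lie on the curve; otherwise it is an eigenvalue of the
  -- pencil.
  by_cases hv0 : v = 0
  · simp [hv0]
  have hl : z₀ - ν⁻¹ ∉ Set.range γ := fun hmem =>
    hoff _ hmem (det_eq_zero_of_mulVec_pow h₀ hν k hv hv0)
  obtain ⟨p, hp⟩ := resolvent_mulVec_of_ne_zero h₀ hν k v hv
  ext i
  rw [h.contourProjector_mulVec hoff, contourIntegral_congr fun z hz =>
    hp z (hoff z hz) (fun e => hl (e ▸ hz)) i,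
    h.contourIntegral_add (f := fun z => v i * (z - (z₀ - ν⁻¹))⁻¹)
      (continuousOn_const.mul (continuousOn_inv_sub hl)) (continuousOn_inv_sq_mul_eval hl _),
    h.contourIntegral_inv_sq_mul_eval hl, contourIntegral_const_mul, windingNumber,
    Pi.smul_apply, smul_eq_mul]
  ring

open Classical in
/-- The contour projector is the identity on the generalized eigenvectors that belong to
eigenvalues inside the contour, and vanishes on the others. -/
lemma IsContour.contourProjector_mulVec (h : IsContour γ)
    (hoff : ∀ z ∈ Set.range γ, (z • B - A).det ≠ 0) {z₀ : ℂ} (h₀ : (z₀ • B - A).det ≠ 0) (ν : ℂ)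
    (k : ℕ) {v : Fin n → ℂ} (hv : ((resolvent A B z₀ - ν • 1) ^ k).mulVec v = 0) :
    (contourProjector A B γ).mulVec v =
      if ν ≠ 0 ∧ z₀ - ν⁻¹ ∈ inside γ then v else 0 := by
  have hC : IsPiecewiseC1 γ := h.piecewise_contDiff
  by_cases hν : ν = 0
  · subst hν
    simpa using hC.contourProjector_mulVec_of_zero hoff h₀ k hv
  by_cases hv0 : v = 0
  · simp [hv0]
  rw [hC.contourProjector_mulVec_of_ne_zero hoff h₀ hν k hv]
  by_cases hin : z₀ - ν⁻¹ ∈ inside γ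
  · simp [hν, hin, h.positive _ hin]
  · have hl : z₀ - ν⁻¹ ∉ Set.range γ := fun hmem =>
      hoff _ hmem (det_eq_zero_of_mulVec_pow h₀ hν k hv hv0)
    simp [hin, hC.windingNumber_eq_zero hl hin]

end Projector

/-! ### Spectral projectors -/

section Spectral

variable {n : ℕ}

open Classical in
/-- `Q` is the projector onto the generalized eigenvectors of `R` whose eigenvalue satisfies `φ`,
along the other ones. -/
def IsSpectralProjector (R Q : Matrix (Fin n) (Fin n) ℂ) (φ : ℂ → Prop) : Prop :=
  ∀ (ν : ℂ) (k : ℕ) (v : Fin n → ℂ), ((R - ν • 1) ^ k).mulVec v = 0 →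
    Q.mulVec v = if φ ν then v else 0

/-- Over `ℂ` the generalized eigenvectors of `R` span the whole space. -/
lemma ext_of_generalized_eigenvectors (R : Matrix (Fin n) (Fin n) ℂ)
    {M N : Matrix (Fin n) (Fin n) ℂ}
    (h : ∀ (ν : ℂ) (k : ℕ) (v : Fin n → ℂ), ((R - ν • 1) ^ k).mulVec v = 0 →
      M.mulVec v = N.mulVec v) : M = N := by
  have htop : ⊤ ≤ LinearMap.eqLocus (Matrix.toLin' M) (Matrix.toLin' N) := by
    rw [← Module.End.iSup_maxGenEigenspace_eq_top (Matrix.toLin' R)]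
    refine iSup_le fun ν v hv => ?_
    obtain ⟨k, hk⟩ := (Module.End.mem_maxGenEigenspace _ _ _).1 hv
    have hM : (Matrix.toLin' R - ν • 1) ^ k = Matrix.toLin' ((R - ν • 1) ^ k) := by
      rw [Matrix.toLin'_pow, map_sub, map_smul, Matrix.toLin'_one]
      rfl
    rw [hM, Matrix.toLin'_apply] at hk
    simpa [LinearMap.mem_eqLocus] using h ν k v hk
  refine Matrix.toLin'.injective (LinearMap.ext fun v => htop (Submodule.mem_top (x := v)))

namespace IsSpectralProjector

variable {R Q : Matrix (Fin n) (Fin n) ℂ} {φ : ℂ → Prop}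

lemma mul_self (h : IsSpectralProjector R Q φ) : Q * Q = Q := by
  refine ext_of_generalized_eigenvectors R fun ν k v hv => ?_
  rw [← Matrix.mulVec_mulVec, h ν k v hv]
  split_ifs with hφ
  · rw [h ν k v hv, if_pos hφ]
  · simp

lemma commute (h : IsSpectralProjector R Q φ) : Q * R = R * Q := by
  refine ext_of_generalized_eigenvectors R fun ν k v hv => ?_
  have hc : Commute ((R - ν • 1) ^ k) R :=
    Commute.pow_left (Commute.sub_left (Commute.refl R) ((Commute.one_left R).smul_left ν)) k
  have hRv : ((R - ν • 1) ^ k).mulVec (R.mulVec v) = 0 := by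
    rw [Matrix.mulVec_mulVec, hc.eq, ← Matrix.mulVec_mulVec, hv, Matrix.mulVec_zero]
  rw [← Matrix.mulVec_mulVec, ← Matrix.mulVec_mulVec, h ν k v hv, h ν k _ hRv]
  split_ifs <;> simp

open Classical in
lemma mulVec_eigenvector (h : IsSpectralProjector R Q φ) {ν : ℂ} {v : Fin n → ℂ}
    (hv : R.mulVec v = ν • v) : Q.mulVec v = if φ ν then v else 0 := by
  refine h ν 1 v ?_
  rw [pow_one, Matrix.sub_mulVec, hv, Matrix.smul_mulVec, Matrix.one_mulVec, sub_self]

lemma of_mulVec_eq_self (h : IsSpectralProjector R Q φ) {ν : ℂ} {v : Fin n → ℂ}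
    (hv : R.mulVec v = ν • v) (hv0 : v ≠ 0) (hQ : Q.mulVec v = v) : φ ν := by
  by_contra hφ
  rw [h.mulVec_eigenvector hv, if_neg hφ] at hQ
  exact hv0 hQ.symm

/-- `det (1 + t R)` splits along the range and the kernel of the projector. -/
lemma det_one_add_smul (h : IsSpectralProjector R Q φ) {r : ℕ} {U : Matrix (Fin n) (Fin r) ℂ}
    {V : Matrix (Fin r) (Fin n) ℂ} (hUV : U * V = Q) (t : ℂ) :
    (1 + t • R).det = (1 + t • (V * R * U)).det * (1 + t • (R * (1 - Q))).det := by
  -- The cross term vanishes because `Q` commutes with `R` and `Q (1 - Q) = 0`.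
  have hfac : (1 + t • R) = (1 + t • (R * Q)) * (1 + t • (R * (1 - Q))) := by
    have h0 : R * Q * (R * (1 - Q)) = 0 := by
      rw [mul_assoc, ← mul_assoc Q, h.commute, mul_assoc R Q, mul_sub, mul_one, h.mul_self,
        sub_self, mul_zero, mul_zero]
    rw [add_mul, one_mul, mul_add, mul_one, smul_mul_smul_comm, h0, mul_sub, mul_one]
    module
  rw [hfac, Matrix.det_mul]
  congr 1
  -- This form lets Sylvester's identity pass to the small determinant.
  have e1 : 1 + t • (R * Q) = 1 + U * (t • (V * R)) := by
    have : U * V * R = R * Q := by rw [hUV, h.commute]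
    rw [Matrix.mul_smul, ← Matrix.mul_assoc, this]
  rw [e1, Matrix.det_one_add_mul_comm, Matrix.smul_mul]

/-- From a kernel vector `v`, `w = (1 - Q) v` satisfies `R w = -t⁻¹ w` and `Q w = 0`. But `φ (-t⁻¹)`
gives `Q w = w`, so `w = 0` and then `v = 0`. -/
lemma det_one_add_smul_ne_zero (h : IsSpectralProjector R Q φ) {t : ℂ}
    (ht : t ≠ 0 → φ (-t⁻¹)) : (1 + t • (R * (1 - Q))).det ≠ 0 := by
  by_cases ht0 : t = 0
  · simp [ht0]
  intro hdet
  obtain ⟨v, hv0, hv⟩ := Matrix.exists_mulVec_eq_zero_iff.2 hdet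
  set w := (1 - Q).mulVec v with hw
  have hv' : v + t • R.mulVec w = 0 := by
    rw [Matrix.add_mulVec, Matrix.one_mulVec, Matrix.smul_mulVec, ← Matrix.mulVec_mulVec] at hv
    exact hv
  have hQw : Q.mulVec w = 0 := by
    rw [hw, Matrix.mulVec_mulVec, mul_sub, mul_one, h.mul_self, sub_self, Matrix.zero_mulVec]
  clear_value w
  have hw' : w + t • R.mulVec w = 0 := by
    have h1 := congrArg (1 - Q).mulVec hv'
    have h2 : (1 - Q).mulVec (R.mulVec w) = R.mulVec w := by
      rw [Matrix.sub_mulVec, Matrix.one_mulVec, Matrix.mulVec_mulVec, h.commute,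
        ← Matrix.mulVec_mulVec, hQw, Matrix.mulVec_zero, sub_zero]
    rwa [Matrix.mulVec_add, Matrix.mulVec_smul, Matrix.mulVec_zero, ← hw, h2] at h1
  have hRw : R.mulVec w = (-t⁻¹) • w := by
    have : t⁻¹ • (w + t • R.mulVec w) = 0 := by rw [hw', smul_zero]
    rw [smul_add, smul_smul, inv_mul_cancel₀ ht0, one_smul] at this
    rw [neg_smul, eq_neg_iff_add_eq_zero, add_comm, this]
  have hw0 := h.mulVec_eigenvector hRw
  rw [if_pos (ht ht0), hQw] at hw0
  rw [← hw0, Matrix.mulVec_zero, smul_zero, add_zero] at hv'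
  exact hv0 hv'

/-- The columns of `U` form a basis of the range of `Q`, and `V` holds the coordinates of the
columns of `Q`. Cancelling the injective `U` in `U V U = Q U = U` gives `V U = 1`. -/
lemma exists_factorization (h : IsSpectralProjector R Q φ) :
    ∃ (r : ℕ) (U : Matrix (Fin n) (Fin r) ℂ) (V : Matrix (Fin r) (Fin n) ℂ),
      U * V = Q ∧ V * U = 1 := by
  let W := LinearMap.range Q.mulVecLin
  let b := Module.finBasis ℂ W
  let U : Matrix (Fin n) (Fin (Module.finrank ℂ W)) ℂ := Matrix.of fun i j => (b j : Fin n → ℂ) i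
  have hU : ∀ y, U.mulVec y = (∑ j, y j • b j : W) := by
    intro y
    ext i
    simp [U, Matrix.mulVec, dotProduct, mul_comm]
  have hUinj : Function.Injective U.mulVec := by
    intro y y' hyy
    rw [hU, hU] at hyy
    exact b.equivFun.symm.injective (by simpa only [b.equivFun_symm_apply] using Subtype.ext hyy)
  let V : Matrix (Fin (Module.finrank ℂ W)) (Fin n) ℂ :=
    Matrix.of fun i j => b.repr ⟨Q.mulVec (Pi.single j 1), LinearMap.mem_range_self Q.mulVecLin _⟩ i
  have hUV : U * V = Q := by
    ext i j
    have h1 : (U * V) i j = U.mulVec (fun k => V k j) i := rfl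
    rw [h1, hU]
    simp only [V, Matrix.of_apply, b.sum_repr]
    simp
  have hQU : Q * U = U := by
    ext i j
    obtain ⟨x, hx⟩ := (b j).2
    have h1 : (Q * U) i j = Q.mulVec (b j : Fin n → ℂ) i := rfl
    rw [h1, ← hx, Matrix.mulVecLin_apply, Matrix.mulVec_mulVec, h.mul_self,
      ← Matrix.mulVecLin_apply, hx]
    rfl
  refine ⟨_, U, V, hUV, ?_⟩
  refine Matrix.ext_of_mulVec_single fun j => hUinj ?_
  rw [Matrix.mulVec_mulVec, ← Matrix.mul_assoc, hUV, hQU, Matrix.one_mulVec]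

end IsSpectralProjector

end Spectral

/-! ### The characteristic polynomial of a pencil -/

section PencilPoly

variable {n : ℕ}

lemma eval_det_eq (P : Matrix (Fin n) (Fin n) ℂ[X]) (z : ℂ) :
    P.det.eval z = (P.map (eval z)).det := by
  rw [← coe_evalRingHom, RingHom.map_det]
  rfl

lemma eval_pencilPoly (A B : Matrix (Fin n) (Fin n) ℂ) (z : ℂ) :
    (pencilPoly A B).eval z = (z • B - A).det := by
  rw [pencilPoly, eval_det_eq]
  congr 1
  ext i j
  simp only [Matrix.map_apply, Matrix.sub_apply, Matrix.smul_apply, smul_eq_mul, eval_sub, eval_mul,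
    eval_X, eval_C]

lemma eval_charpoly (M : Matrix (Fin n) (Fin n) ℂ) (z : ℂ) :
    M.charpoly.eval z = (z • 1 - M).det := by
  rw [Matrix.charpoly, eval_det_eq]
  congr 1
  ext i j
  by_cases hij : i = j
  · subst hij; simp [Matrix.charmatrix_apply_eq]
  · simp [Matrix.charmatrix_apply_ne _ _ _ hij, Matrix.one_apply_ne hij]

lemma card_roots_charpoly (M : Matrix (Fin n) (Fin n) ℂ) : M.charpoly.roots.card = n := by
  rw [splits_iff_card_roots.1 (IsAlgClosed.splits M.charpoly), Matrix.charpoly_natDegree_eq_dim,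
    Fintype.card_fin]

lemma mem_roots_charpoly {M : Matrix (Fin n) (Fin n) ℂ} {μ : ℂ} :
    μ ∈ M.charpoly.roots ↔ ∃ y ≠ 0, M.mulVec y = μ • y := by
  rw [mem_roots M.charpoly_monic.ne_zero, IsRoot.def, eval_charpoly,
    ← Matrix.exists_mulVec_eq_zero_iff]
  refine exists_congr fun y => and_congr_right fun _ => ?_
  rw [Matrix.sub_mulVec, Matrix.smul_mulVec, Matrix.one_mulVec, sub_eq_zero, eq_comm]

end PencilPoly

/-! ### Bases of the range of a spectral projector -/

section Exact

variable {n r : ℕ} {A B Q : Matrix (Fin n) (Fin n) ℂ} {z₀ : ℂ} {D : Set ℂ}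
  {U : Matrix (Fin n) (Fin r) ℂ} {V : Matrix (Fin r) (Fin n) ℂ}

/-- The pencil acts on the range of `U` as the matrix `M`, whose spectrum is the part in `D` of the
spectrum of the pencil. -/
structure IsDeflation (A B : Matrix (Fin n) (Fin n) ℂ) (D : Set ℂ) (U : Matrix (Fin n) (Fin r) ℂ)
    (M : Matrix (Fin r) (Fin r) ℂ) : Prop where
  mul_eq : A * U = B * U * M
  injective : Function.Injective (B * U).mulVec
  roots_eq : eigenvaluesIn A B D = M.charpoly.roots
  exists_mulVec : ∀ (μ : ℂ) (x : Fin n → ℂ), μ ∈ D → A.mulVec x = μ • B.mulVec x →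
    ∃ y, U.mulVec y = x

open Classical in
-- `K = V R U` represents `R` on the range of `Q`, where 0 is not an eigenvalue. So `K` is
-- invertible, and `B U = (z₀ B - A) U K` rearranges to `A U = B U (z₀ - K⁻¹)`.
lemma exists_isDeflation (h₀ : (z₀ • B - A).det ≠ 0)
    (hQ : IsSpectralProjector (resolvent A B z₀) Q (fun ν => ν ≠ 0 ∧ z₀ - ν⁻¹ ∈ D))
    (hUV : U * V = Q) (hVU : V * U = 1) : ∃ M, IsDeflation A B D U M := by
  set R := resolvent A B z₀ with hR
  set K := V * R * U with hK
  have hQU : Q * U = U := by rw [← hUV, Matrix.mul_assoc, hVU, Matrix.mul_one]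
  have hUinj : Function.Injective U.mulVec := by
    refine Function.LeftInverse.injective (g := V.mulVec) fun y => ?_
    rw [Matrix.mulVec_mulVec, hVU, Matrix.one_mulVec]
  have hUK : U * K = R * U := by
    rw [hK, ← Matrix.mul_assoc, ← Matrix.mul_assoc, hUV, hQ.commute, Matrix.mul_assoc, hQU]
  have hQUy : ∀ y, Q.mulVec (U.mulVec y) = U.mulVec y := fun y => by
    rw [Matrix.mulVec_mulVec, hQU]
  have hKdet : K.det ≠ 0 := by
    intro hdet
    obtain ⟨y, hy0, hy⟩ := Matrix.exists_mulVec_eq_zero_iff.2 hdet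
    have hRU : R.mulVec (U.mulVec y) = (0 : ℂ) • U.mulVec y := by
      rw [Matrix.mulVec_mulVec, ← hUK, ← Matrix.mulVec_mulVec, hy, Matrix.mulVec_zero, zero_smul]
    have hne : U.mulVec y ≠ 0 := fun e => hy0 (hUinj (e.trans (Matrix.mulVec_zero U).symm))
    exact (hQ.of_mulVec_eq_self hRU hne (hQUy y)).1 rfl
  have hKu : IsUnit K.det := isUnit_iff_ne_zero.2 hKdet
  have hBU : B * U = (z₀ • B - A) * U * K := by
    rw [Matrix.mul_assoc, hUK, ← Matrix.mul_assoc, pencil_mul_resolvent h₀]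
  have hBUK : B * U * K⁻¹ = (z₀ • B - A) * U := by
    rw [hBU, Matrix.mul_assoc _ K, Matrix.mul_nonsing_inv _ hKu, Matrix.mul_one]
  set M := z₀ • 1 - K⁻¹ with hM
  -- An eigenvector `y` of `M` gives an eigenvector `U y` of `R` for `(z₀ - μ)⁻¹` that `Q` fixes.
  have hroots : ∀ μ ∈ M.charpoly.roots, μ ∈ D := by
    intro μ hμ
    obtain ⟨y, hy0, hy⟩ := mem_roots_charpoly.1 hμ
    have hKy : K⁻¹.mulVec y = (z₀ - μ) • y := by
      rw [hM, Matrix.sub_mulVec, Matrix.smul_mulVec, Matrix.one_mulVec] at hy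
      linear_combination (norm := module) -hy
    have hKy' : y = (z₀ - μ) • K.mulVec y := by
      rw [← Matrix.mulVec_smul, ← hKy, Matrix.mulVec_mulVec, Matrix.mul_nonsing_inv _ hKu,
        Matrix.one_mulVec]
    have hne : z₀ - μ ≠ 0 := fun e => hy0 (by rw [hKy', e, zero_smul])
    have hKy2 : K.mulVec y = (z₀ - μ)⁻¹ • y := by
      conv_rhs => rw [hKy']
      rw [smul_smul, inv_mul_cancel₀ hne, one_smul]
    have hRU : R.mulVec (U.mulVec y) = (z₀ - μ)⁻¹ • U.mulVec y := by
      rw [Matrix.mulVec_mulVec, ← hUK, ← Matrix.mulVec_mulVec, hKy2, Matrix.mulVec_smul]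
    have hUy : U.mulVec y ≠ 0 := fun e => hy0 (hUinj (e.trans (Matrix.mulVec_zero U).symm))
    have := (hQ.of_mulVec_eq_self hRU hUy (hQUy y)).2
    rwa [inv_inv, sub_sub_cancel] at this
  refine ⟨M, ?_, ?_, ?_, ?_⟩
  · rw [hM, Matrix.mul_sub, hBUK, Matrix.mul_smul, Matrix.mul_one, Matrix.sub_mul, Matrix.smul_mul]
    module
  · refine Function.LeftInverse.injective (g := (K⁻¹ * V * (z₀ • B - A)⁻¹).mulVec) fun y => ?_
    have e1 : K⁻¹ * V * (z₀ • B - A)⁻¹ * (B * U) = 1 := by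
      rw [hBU, Matrix.mul_assoc (z₀ • B - A), Matrix.mul_assoc (K⁻¹ * V),
        ← Matrix.mul_assoc (z₀ • B - A)⁻¹, pencil_inv_mul h₀, Matrix.one_mul,
        Matrix.mul_assoc K⁻¹, ← Matrix.mul_assoc V, hVU, Matrix.one_mul,
        Matrix.nonsing_inv_mul _ hKu]
    rw [Matrix.mulVec_mulVec, e1, Matrix.one_mulVec]
  -- `H` is the factor of `det (z B - A)` coming from the kernel of `Q`; it has no zero in `D`, and
  -- `H(z₀) = 1`.
  · set H : ℂ[X] := (1 + ((X : ℂ[X]) - C z₀) • (R * (1 - Q)).map C).det with hH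
    have hHeval : ∀ z, H.eval z = (1 + (z - z₀) • (R * (1 - Q))).det := by
      intro z
      rw [hH, eval_det_eq]
      congr 1
      ext i j
      by_cases hij : i = j
      · subst hij; simp [-Matrix.map_mul]
      · simp [-Matrix.map_mul, Matrix.one_apply_ne hij]
    have hfac : pencilPoly A B = C ((z₀ • B - A).det * K.det) * (M.charpoly * H) := by
      refine Polynomial.funext fun z => ?_
      rw [eval_pencilPoly, pencil_eq_mul h₀ z, Matrix.det_mul, ← hR,
        hQ.det_one_add_smul hUV, eval_mul, eval_C, eval_mul, eval_charpoly, hHeval, ← hK]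
      have : 1 + (z - z₀) • K = K * (z • 1 - M) := by
        rw [hM, Matrix.mul_sub, Matrix.mul_sub, Matrix.mul_nonsing_inv _ hKu]
        simp only [Matrix.mul_smul, Matrix.mul_one]
        module
      rw [this, Matrix.det_mul]
      ring
    have hHne : ∀ z ∈ D, H.eval z ≠ 0 := by
      intro z hz
      rw [hHeval]
      refine hQ.det_one_add_smul_ne_zero fun ht => ⟨by simpa using ht, ?_⟩
      have : z₀ - (-(z - z₀)⁻¹)⁻¹ = z := by rw [inv_neg, inv_inv]; ring
      rwa [this]
    have hH0 : H ≠ 0 := by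
      intro e
      have := hHeval z₀
      rw [e] at this
      simp at this
    have hc : (z₀ • B - A).det * K.det ≠ 0 := mul_ne_zero h₀ hKdet
    rw [eigenvaluesIn, eigenvalues, hfac, roots_C_mul _ hc,
      roots_mul (mul_ne_zero M.charpoly_monic.ne_zero hH0), Multiset.filter_add,
      Multiset.filter_eq_self.2 hroots, Multiset.filter_eq_nil.2, add_zero]
    exact fun z hz hzD => hHne z hzD ((mem_roots hH0).1 hz)
  · intro μ x hμ hx
    by_cases hx0 : x = 0
    · exact ⟨0, by rw [hx0, Matrix.mulVec_zero]⟩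
    have h1 : (z₀ • B - A).mulVec x = (z₀ - μ) • B.mulVec x := by
      rw [Matrix.sub_mulVec, Matrix.smul_mulVec, hx]
      module
    have h2 : x = (z₀ - μ) • R.mulVec x := by
      have := congrArg (z₀ • B - A)⁻¹.mulVec h1
      rwa [Matrix.mulVec_mulVec, pencil_inv_mul h₀, Matrix.one_mulVec, Matrix.mulVec_smul,
        Matrix.mulVec_mulVec] at this
    have hne : z₀ - μ ≠ 0 := fun e => hx0 (by rw [h2, e, zero_smul])
    have h3 : R.mulVec x = (z₀ - μ)⁻¹ • x := by
      conv_rhs => rw [h2]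
      rw [smul_smul, inv_mul_cancel₀ hne, one_smul]
    have h4 := hQ.mulVec_eigenvector h3
    rw [if_pos ⟨inv_ne_zero hne, by rwa [inv_inv, sub_sub_cancel]⟩, ← hUV,
      ← Matrix.mulVec_mulVec] at h4
    exact ⟨_, h4⟩

namespace IsDeflation

variable {M : Matrix (Fin r) (Fin r) ℂ}

lemma card_eigenvaluesIn (h : IsDeflation A B D U M) : (eigenvaluesIn A B D).card = r := by
  rw [h.roots_eq, card_roots_charpoly]

lemma mulVec_injective (h : IsDeflation A B D U M) : Function.Injective U.mulVec := by
  intro y y' hyy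
  refine h.injective ?_
  rw [← Matrix.mulVec_mulVec, ← Matrix.mulVec_mulVec, hyy]

/-- Makes the projected pencil a left multiple of `z - M`, so that its spectral data can be read off
`M`. -/
lemma obliqueProj_left (h : IsDeflation A B D U M) :
    obliqueProj B U A = obliqueProj B U B * M := by
  rw [obliqueProj, obliqueProj, Matrix.mul_assoc, h.mul_eq]
  simp only [Matrix.mul_assoc]

open scoped ComplexOrder in
-- This is the Gram matrix of the independent columns of `B U`.
lemma det_obliqueProj_ne_zero (h : IsDeflation A B D U M) : (obliqueProj B U B).det ≠ 0 := by
  intro hdet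
  obtain ⟨y, hy0, hy⟩ := Matrix.exists_mulVec_eq_zero_iff.2 hdet
  rw [obliqueProj, Matrix.mul_assoc, Matrix.conjTranspose_mul_self_mulVec_eq_zero] at hy
  exact hy0 (h.injective (hy.trans (Matrix.mulVec_zero _).symm))

lemma eigen_iff (h : IsDeflation A B D U M) {μ : ℂ} {y : Fin r → ℂ} :
    (obliqueProj B U A).mulVec y = μ • (obliqueProj B U B).mulVec y ↔ M.mulVec y = μ • y := by
  rw [h.obliqueProj_left, ← Matrix.mulVec_mulVec, ← Matrix.mulVec_smul]
  exact (Matrix.mulVec_injective_of_isUnit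
    ((Matrix.isUnit_iff_isUnit_det _).2 (isUnit_iff_ne_zero.2 h.det_obliqueProj_ne_zero))).eq_iff

lemma eigen_iff' (h : IsDeflation A B D U M) {μ : ℂ} {y : Fin r → ℂ} :
    A.mulVec (U.mulVec y) = μ • B.mulVec (U.mulVec y) ↔ M.mulVec y = μ • y := by
  rw [Matrix.mulVec_mulVec, Matrix.mulVec_mulVec, h.mul_eq, ← Matrix.mulVec_mulVec,
    ← Matrix.mulVec_smul]
  exact h.injective.eq_iff

lemma mulVec_ne_zero (h : IsDeflation A B D U M) {y : Fin r → ℂ} : U.mulVec y ≠ 0 ↔ y ≠ 0 := by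
  rw [Ne, ← Matrix.mulVec_zero U, h.mulVec_injective.eq_iff]

open Classical in
lemma mem_of_eigenvector (h : IsDeflation A B D U M) {μ : ℂ} {y : Fin r → ℂ} (hy0 : y ≠ 0)
    (hy : M.mulVec y = μ • y) : μ ∈ D := by
  have := mem_roots_charpoly.2 ⟨y, hy0, hy⟩
  rw [← h.roots_eq, eigenvaluesIn] at this
  exact (Multiset.mem_filter.1 this).2

lemma pencilPoly_obliqueProj (h : IsDeflation A B D U M) :
    pencilPoly (obliqueProj B U A) (obliqueProj B U B) =
      C (obliqueProj B U B).det * M.charpoly := by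
  refine Polynomial.funext fun z => ?_
  rw [eval_pencilPoly, eval_mul, eval_C, eval_charpoly, ← Matrix.det_mul, h.obliqueProj_left,
    Matrix.mul_sub, Matrix.mul_smul, Matrix.mul_one]

/-- The projection onto a deflating subspace recovers its part of the spectrum. -/
lemma projectionIsExact (h : IsDeflation A B D U M) : ProjectionIsExact A B D U := by
  have heig : eigenvalues (obliqueProj B U A) (obliqueProj B U B) = eigenvaluesIn A B D := by
    rw [eigenvalues, h.pencilPoly_obliqueProj, roots_C_mul _ h.det_obliqueProj_ne_zero, h.roots_eq]
  refine ⟨?_, ?_, ?_, ?_, heig, ?_⟩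
  · by_contra hcon
    have h0 : pencilPoly (obliqueProj B U A) (obliqueProj B U B) = 0 := by
      refine Polynomial.funext fun z => ?_
      rw [eval_pencilPoly, eval_zero]
      by_contra hz
      exact hcon ⟨z, hz⟩
    rw [h.pencilPoly_obliqueProj] at h0
    exact mul_ne_zero (C_ne_zero.2 h.det_obliqueProj_ne_zero) M.charpoly_monic.ne_zero h0
  · rintro μ y ⟨hy0, hy⟩
    have hy := h.eigen_iff.1 hy
    exact ⟨h.mem_of_eigenvector hy0 hy, h.mulVec_ne_zero.2 hy0, h.eigen_iff'.2 hy⟩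
  · rintro μ x hμ ⟨hx0, hx⟩
    obtain ⟨y, rfl⟩ := h.exists_mulVec μ x hμ hx
    exact ⟨y, ⟨h.mulVec_ne_zero.1 hx0, h.eigen_iff.2 (h.eigen_iff'.1 hx)⟩, rfl⟩
  · rw [heig, h.card_eigenvaluesIn]
  · rintro μ ⟨y, hy0, hy⟩
    have hμ := h.mem_of_eigenvector hy0 (h.eigen_iff.1 hy)
    have hmem : ∀ {m : ℕ} (A B : Matrix (Fin m) (Fin m) ℂ) (x : Fin m → ℂ),
        x ∈ eigenspace A B μ ↔ A.mulVec x = μ • B.mulVec x := by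
      intro m A B x
      rw [eigenspace, LinearMap.mem_ker, Matrix.mulVecLin_apply, Matrix.sub_mulVec,
        Matrix.smul_mulVec, sub_eq_zero]
    ext x
    rw [Submodule.mem_map, hmem]
    constructor
    · rintro ⟨y, hy, rfl⟩
      exact h.eigen_iff'.2 (h.eigen_iff.1 ((hmem _ _ _).1 hy))
    · intro hx
      obtain ⟨y, rfl⟩ := h.exists_mulVec μ x hμ hx
      exact ⟨y, (hmem _ _ _).2 (h.eigen_iff.2 (h.eigen_iff'.1 hx)), rfl⟩

end IsDeflation

end Exact

/-! ### Zeros of polynomials in independent random variables -/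

section Random

lemma measurable_eval_ofReal {N : ℕ} (p : MvPolynomial (Fin N) ℂ) :
    Measurable fun y : Fin N → ℝ => MvPolynomial.eval (fun i => (y i : ℂ)) p :=
  (p.continuous_eval.comp (by fun_prop)).measurable

/-- A nonzero polynomial does not vanish almost everywhere for a product of diffuse measures. -/
lemma ae_eval_ofReal_ne_zero (ν : Measure ℝ) [IsProbabilityMeasure ν] [NullSingletonClass ν]
    {N : ℕ} (p : MvPolynomial (Fin N) ℂ) (hp : p ≠ 0) :
    ∀ᵐ y ∂Measure.pi (fun _ : Fin N => ν), MvPolynomial.eval (fun i => (y i : ℂ)) p ≠ 0 := by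
  induction N with
  | zero =>
    refine Filter.Eventually.of_forall fun y => ?_
    rw [MvPolynomial.eq_C_of_isEmpty p, MvPolynomial.eval_C]
    intro h0
    exact hp (by rw [MvPolynomial.eq_C_of_isEmpty p, h0, map_zero])
  | succ N ih =>
    -- Regard `p` as a polynomial in the first variable; by induction its leading coefficient is
    -- almost surely nonzero in the others.
    set q := MvPolynomial.finSuccEquiv ℂ N p with hq
    have hq0 : q ≠ 0 := (MvPolynomial.finSuccEquiv ℂ N).map_ne_zero_iff.2 hp
    have hlead := ih q.leadingCoeff (leadingCoeff_ne_zero.2 hq0)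
    have hmeas : MeasurableSet {z : ℝ × (Fin N → ℝ) |
        MvPolynomial.eval (fun i => ((Fin.cons z.1 z.2 : Fin (N + 1) → ℝ) i : ℂ)) p ≠ 0} := by
      have : Measurable fun z : ℝ × (Fin N → ℝ) => (Fin.cons z.1 z.2 : Fin (N + 1) → ℝ) := by
        refine measurable_pi_lambda _ fun i => ?_
        refine Fin.cases ?_ (fun j => ?_) i
        · simpa using measurable_fst
        · simpa [Function.comp_def] using (measurable_pi_apply j).comp measurable_snd
      exact ((measurable_eval_ofReal p).comp this) (measurableSet_singleton 0).compl
    have hprod : ∀ᵐ z ∂ν.prod (Measure.pi fun _ : Fin N => ν),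
        MvPolynomial.eval (fun i => ((Fin.cons z.1 z.2 : Fin (N + 1) → ℝ) i : ℂ)) p ≠ 0 := by
      -- Fubini with the other variables `y` fixed first: for almost every `y` only finitely many
      -- `x` are roots, and `ν` has no atoms.
      rw [Measure.ae_prod_iff_ae_ae hmeas, Measure.ae_ae_comm hmeas]
      filter_upwards [hlead] with y hy
      set qy := q.map (MvPolynomial.eval fun i => (y i : ℂ)) with hqy
      have hqy0 : qy ≠ 0 := by
        intro h0
        have := congrArg (fun f => f.coeff q.natDegree) h0
        simp only [hqy, coeff_map, coeff_zero] at this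
        exact hy this
      have hfin : {x : ℝ | (x : ℂ) ∈ qy.roots.toFinset}.Finite :=
        qy.roots.toFinset.finite_toSet.preimage Complex.ofReal_injective.injOn
      filter_upwards [hfin.countable.ae_notMem ν] with x hx h0
      refine hx ?_
      have hcons : (fun i => ((Fin.cons x y : Fin (N + 1) → ℝ) i : ℂ)) =
          Fin.cons (x : ℂ) fun i => (y i : ℂ) := by
        funext i
        refine Fin.cases ?_ (fun j => ?_) i <;> simp
      rw [hcons, MvPolynomial.eval_eq_eval_mv_eval'] at h0
      simpa [hqy0] using h0
    have hmp := measurePreserving_piFinSuccAbove (fun _ : Fin (N + 1) => ν) 0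
    refine (hmp.quasiMeasurePreserving.ae hprod).mono fun y hy => ?_
    convert hy using 4 with i
    refine Fin.cases ?_ (fun j => ?_) i <;> simp [MeasurableEquiv.piFinSuccAbove, Fin.tail]

/-- If `V` is a matrix with a right inverse, then `V Y` is almost surely invertible for a random
matrix `Y` with independent entries of the same diffuse law. -/
lemma ae_det_mul_ne_zero {n s : ℕ} {U : Matrix (Fin n) (Fin s) ℂ} {V : Matrix (Fin s) (Fin n) ℂ}
    (hVU : V * U = 1) {Ω : Type*} [MeasurableSpace Ω] (P : Measure Ω) [IsProbabilityMeasure P]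
    (ν : Measure ℝ) [IsProbabilityMeasure ν] [NullSingletonClass ν] (Y : Fin n → Fin s → Ω → ℝ)
    (hlaw : ∀ i j, HasLaw (Y i j) ν P) (hind : iIndepFun (fun p : Fin n × Fin s => Y p.1 p.2) P) :
    ∀ᵐ ω ∂P, (V * Matrix.of fun i j => (Y i j ω : ℂ)).det ≠ 0 := by
  let e := Fintype.equivFin (Fin n × Fin s)
  let p : MvPolynomial (Fin (Fintype.card (Fin n × Fin s))) ℂ :=
    (Matrix.of fun i j => ∑ k, MvPolynomial.C (V i k) * MvPolynomial.X (e (k, j))).det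
  have hp : ∀ x, MvPolynomial.eval x p = (V * Matrix.of fun k j => x (e (k, j))).det := by
    intro x
    rw [RingHom.map_det]
    congr 1
    ext i j
    simp [Matrix.mul_apply]
  have hp0 : p ≠ 0 := by
    intro h0
    -- At the complex point `Y = U` the determinant is 1. Being nonzero over `ℂ` is enough, though
    -- the random entries are real.
    have h1 := hp fun k => U (e.symm k).1 (e.symm k).2
    have h2 : (Matrix.of fun k j => U (e.symm (e (k, j))).1 (e.symm (e (k, j))).2) = U := by
      ext k j
      simp
    rw [h2, hVU, h0] at h1
    simp at h1
  let Z : Fin (Fintype.card (Fin n × Fin s)) → Ω → ℝ := fun k => Y (e.symm k).1 (e.symm k).2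
  have hZ : ∀ k, AEMeasurable (Z k) P := fun k => (hlaw _ _).aemeasurable
  have hZind : iIndepFun Z P := hind.precomp e.symm.injective
  -- Independence and the common law make the joint law a product measure.
  have hmap : P.map (fun ω k => Z k ω) = Measure.pi fun _ => ν := by
    rw [(iIndepFun_iff_map_fun_eq_pi_map hZ).1 hZind]
    congr 1
    funext k
    exact (hlaw _ _).map_eq
  have hae := ae_eval_ofReal_ne_zero ν p hp0
  rw [← hmap] at hae
  filter_upwards [ae_of_ae_map (aemeasurable_pi_lambda _ hZ) hae] with ω hω
  rw [hp] at hω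
  simpa [Z] using hω

end Random

end ObliqueFEAST
end

theorem theorem3p2 {n : ℕ} (A B : Matrix (Fin n) (Fin n) ℂ)
    (hreg : ObliqueFEAST.IsRegularPencil A B)
    {c : ℂ} (γ : Path c c) (hγ : ObliqueFEAST.IsContour γ)
    (hoff : ∀ z ∈ Set.range γ, (z • B - A).det ≠ 0)
    (s : ℕ) (hs : s = (ObliqueFEAST.eigenvaluesIn A B (ObliqueFEAST.inside γ)).card) :
    -- every starting matrix for which `U = Q Y` has linearly independent columns
    (∀ Y : Matrix (Fin n) (Fin s) ℂ,
      LinearIndependent ℂ (ObliqueFEAST.contourProjector A B γ * Y).col →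
      ObliqueFEAST.ProjectionIsExact A B (ObliqueFEAST.inside γ)
        (ObliqueFEAST.contourProjector A B γ * Y)) ∧
    -- a random real starting matrix with i.i.d. entries from a continuous distribution `ν`
    (∀ {Ω : Type*} [MeasurableSpace Ω] (P : MeasureTheory.Measure Ω)
      [MeasureTheory.IsProbabilityMeasure P]
      (ν : MeasureTheory.Measure ℝ) [MeasureTheory.IsProbabilityMeasure ν]
      [MeasureTheory.NullSingletonClass ν]
      (Y : Fin n → Fin s → Ω → ℝ),
      (∀ i j, ProbabilityTheory.HasLaw (Y i j) ν P) →
      ProbabilityTheory.iIndepFun (fun p : Fin n × Fin s => Y p.1 p.2) P →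
      ∀ᵐ ω ∂P,
        LinearIndependent ℂ
          (ObliqueFEAST.contourProjector A B γ * Matrix.of fun i j => (Y i j ω : ℂ)).col ∧
        ObliqueFEAST.ProjectionIsExact A B (ObliqueFEAST.inside γ)
          (ObliqueFEAST.contourProjector A B γ * Matrix.of fun i j => (Y i j ω : ℂ))) := by
  obtain ⟨z₀, h₀⟩ := hreg
  set Q := ObliqueFEAST.contourProjector A B γ
  have hQ : ObliqueFEAST.IsSpectralProjector (ObliqueFEAST.resolvent A B z₀) Q
      (fun ν => ν ≠ 0 ∧ z₀ - ν⁻¹ ∈ ObliqueFEAST.inside γ) :=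
    fun ν k v hv => by convert hγ.contourProjector_mulVec hoff h₀ ν k hv
  obtain ⟨r, U, V, hUV, hVU⟩ := hQ.exists_factorization
  obtain ⟨M, hM⟩ := ObliqueFEAST.exists_isDeflation h₀ hQ hUV hVU
  -- The rank of `Q` is the number of eigenvalues inside; this makes `V Y` square.
  obtain rfl : s = r := hs.trans hM.card_eigenvaluesIn
  have hQY : ∀ Y : Matrix (Fin n) (Fin s) ℂ, Q * Y = U * (V * Y) := fun Y => by
    rw [← hUV, Matrix.mul_assoc]
  have main : ∀ Y : Matrix (Fin n) (Fin s) ℂ, LinearIndependent ℂ (Q * Y).col →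
      ObliqueFEAST.ProjectionIsExact A B (ObliqueFEAST.inside γ) (Q * Y) := by
    intro Y hY
    have hdet : (V * Y).det ≠ 0 := by
      intro hdet
      obtain ⟨y, hy0, hy⟩ := Matrix.exists_mulVec_eq_zero_iff.2 hdet
      refine hy0 (Matrix.mulVec_injective_iff.2 hY ?_)
      rw [hQY, ← Matrix.mulVec_mulVec, hy, Matrix.mulVec_zero, Matrix.mulVec_zero]
    have hu : IsUnit (V * Y).det := isUnit_iff_ne_zero.2 hdet
    -- The columns of `Q Y` are another basis of the range of `Q`, with coordinate matrix `(V Y)⁻¹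
    -- V`.
    obtain ⟨M', hM'⟩ := ObliqueFEAST.exists_isDeflation (U := Q * Y) (V := (V * Y)⁻¹ * V) h₀ hQ
      (by rw [hQY, Matrix.mul_assoc, ← Matrix.mul_assoc (V * Y),
        Matrix.mul_nonsing_inv _ hu, Matrix.one_mul, hUV])
      (by rw [hQY, Matrix.mul_assoc, ← Matrix.mul_assoc V, hVU, Matrix.one_mul,
        Matrix.nonsing_inv_mul _ hu])
    exact hM'.projectionIsExact
  refine ⟨main, fun P _ ν _ _ Y hlaw hind => ?_⟩
  filter_upwards [ObliqueFEAST.ae_det_mul_ne_zero hVU P ν Y hlaw hind] with ω hω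
  refine (fun h => ⟨h, main _ h⟩) (Matrix.mulVec_injective_iff.1 ?_)
  rw [hQY]
  refine Function.LeftInverse.injective
    (g := ((V * Matrix.of fun i j => (Y i j ω : ℂ))⁻¹ * V).mulVec) fun y => ?_
  rw [Matrix.mulVec_mulVec, Matrix.mul_assoc, ← Matrix.mul_assoc V U, hVU, Matrix.one_mul,
    Matrix.nonsing_inv_mul _ (isUnit_iff_ne_zero.2 hω), Matrix.one_mulVec]
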